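/- Let $B=[-1,1]^3$ with marked boundary points NW $=(-1,1,0)$, NE $=(1,1,0)$, SW $=(-1,-1,0)$, SE $=(1,-1,0)$, i.e. the corners of the projection square in the $(x,y)$-plane. Let $[0]$ be the crossingless tangle joining NW to NE and SW to SE, $[1]$ the one-crossing tangle whose upper strand has positive slope, $S+T$ the horizontal juxtaposition of tangles ($S$ on the left), $-T$ the mirror image, $1/T$ the image of $T$ under reflection in the diagonal line through NW and SE, $[\infty]=1/[0]$, and $[n]$ for $n\in\mathbb Z$ the horizontal twist with $|n|$ crossings of the sign of $n$, $[-n]=-[n]$. A \emph{rational tangle} is a tangle isotopic, by an isotopy of $B$ fixing $\partial B$, to $[\infty]$ or to $$[a_1\,a_2\cdots a_m]=[a_m]+\cfrac1{[a_{m-1}]+\cfrac1{\ddots+\cfrac1{[a_1]}}},\qquad m\ge1,\ a_i\in\mathbb Z .$$ A tangle $R$ has connectivity type $[0]$ if it connects NW with NE and SW with SE, type $[\infty]$ if it connects NW with SW and NE with SE, and type $[1]$ if it connects NW with SE and SW with NE. The solid torus closure $\overline R$ is obtained by embedding the projection square in an annulus $S^1\times I$, and $B$ in the solid torus $(S^1\times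 I)\times I$, and joining NW to SW and NE to SE by two parallel arcs running around the annulus. A rational link in the solid torus is a link ambient isotopic in the solid torus to $\overline R$ for some rational tangle $R$. Two links have the same homotopy type if they have parametrizations by the same disjoint union of circles that are homotopic as maps into the solid torus. Theorem. Let $L$ be a rational link in the solid torus, with underlying rational tangle $R$. Then one of the following holds: 1. $R$ has connectivity type $[\infty]$, and $L$ is a two-component link of the homotopy type of two parallel copies of the core of the solid torus; 2. $R$ has connectivity type $[0]$, and $L$ is a knot of the homotopy type of the trivial knot (a circle bounding a disc in the annulus); 3. $R$ has connectivity type $[1]$, and $L$ is a knot of the homotopy type of the knot that goes twice around the solid torus and whose projection to the annulus has exactly one crossing. -/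

import Mathlib

/-- Three-dimensional space with coordinates `(x, y, z)`; diagrams are projections to the
`(x, y)`-plane, and larger `z` means closer to the viewer. -/
abbrev Space : Type := ℝ × ℝ × ℝ

/-- The solid torus `S¹ × I × I`: the thickening (last coordinate, height) of the annulus
`S¹ × I` (angular and radial coordinate). -/
abbrev SolidTorus : Type := Circle × Set.Icc ((-2, -2) : ℝ × ℝ) (2, 2)

/-- `S` is carried to `S'` by an ambient isotopy of `X` that fixes `B` pointwise. -/
def AmbientIsotopicRel {X : Type*} [TopologicalSpace X] (B S S' : Set X) : Prop :=
  ∃ H : unitInterval → X ≃ₜ X,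
    Continuous (fun p : unitInterval × X => H p.1 p.2) ∧
    H 0 = Homeomorph.refl X ∧
    (∀ t, ∀ x ∈ B, H t x = x) ∧
    H 1 '' S = S'

namespace Tangle

/-- The open box `(-1, 1)³`, the interior of the closed 3-ball `[-1, 1]³` containing the tangles. -/
def openBox : Set Space := {v | |v.1| < 1 ∧ |v.2.1| < 1 ∧ |v.2.2| < 1}

/-- The four end points. -/
def NW : Space := (-1, 1, 0)
def NE : Space := (1, 1, 0)
def SW : Space := (-1, -1, 0)
def SE : Space := (1, -1, 0)

/-- The tangle `[0]`: an arc from NW to NE and an arc from SW to SE, without crossing. -/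
def zero : Set Space :=
  segment ℝ NW (0, 1 / 2, 0) ∪ segment ℝ (0, 1 / 2, 0) NE ∪
    (segment ℝ SW (0, -1 / 2, 0) ∪ segment ℝ (0, -1 / 2, 0) SE)

/-- The tangle `[1]`: one crossing, the upper strand has positive slope. -/
def one : Set Space :=
  segment ℝ SW (0, 0, 1 / 2) ∪ segment ℝ (0, 0, 1 / 2) NE ∪
    (segment ℝ NW (0, 0, -1 / 2) ∪ segment ℝ (0, 0, -1 / 2) SE)

/-- The mirror image `-T`: all crossings of the diagram are switched. -/
def neg (T : Set Space) : Set Space := (fun v : Space => (v.1, v.2.1, -v.2.2)) '' T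

/-- `1 / T`: the diagram is reflected in the diagonal line through NW and SE. -/
def inv (T : Set Space) : Set Space := (fun v : Space => (-v.2.1, -v.1, v.2.2)) '' T

/-- The tangle `[∞] = 1 / [0]`. -/
def infty : Set Space := inv zero

/-- The box `[-1, 1]³` shrunk by the factor `1 / 4` and moved to the centre `(c, 0, 0)`. -/
noncomputable def shrink (c : ℝ) (v : Space) : Space := (c + v.1 / 4, v.2.1 / 4, v.2.2 / 4)

/-- The sum `S + T`: a small copy of `S` on the left and one of `T` on the right. The NE and SE
ends of `S` are connected to the NW and SW ends of `T`, and the four other ends to the corners. -/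
noncomputable def sum (S T : Set Space) : Set Space :=
  shrink (-1 / 2) '' S ∪ shrink (1 / 2) '' T ∪
    (segment ℝ NW (shrink (-1 / 2) NW) ∪ segment ℝ SW (shrink (-1 / 2) SW)) ∪
    (segment ℝ (shrink (-1 / 2) NE) (shrink (1 / 2) NW) ∪
      segment ℝ (shrink (-1 / 2) SE) (shrink (1 / 2) SW)) ∪
    (segment ℝ (shrink (1 / 2) NE) NE ∪ segment ℝ (shrink (1 / 2) SE) SE)

/-- The horizontal twists `[n] = [0] + [1] + ⋯ + [1]` for `n ≥ 0`. -/
noncomputable def ofNat : ℕ → Set Space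
  | 0 => zero
  | n + 1 => sum (ofNat n) one

/-- The integer tangles: `[n]`, and `[-n] = -[n]`. -/
noncomputable def ofInt : ℤ → Set Space
  | Int.ofNat n => ofNat n
  | Int.negSucc n => neg (ofNat (n + 1))

/-- The continued fraction of tangles `[b₁] + 1/([b₂] + 1/(⋯ + 1/[bₘ]))`. In the notation
`[a₁ a₂ ⋯ aₘ]` that lists the entries in the order of creation (innermost first), `bᵢ = aₘ₊₁₋ᵢ`.
The empty list gives `[∞]`. -/
noncomputable def contFrac : List ℤ → Set Space
  | [] => infty
  | [b] => ofInt b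
  | b :: c :: l => sum (ofInt b) (inv (contFrac (c :: l)))

/-- A rational tangle: one that is isotopic, by an isotopy of the box fixing its boundary, to a
tangle `[a₁ a₂ ⋯ aₘ]`. (The isotopy is extended by the identity outside the box.) -/
def IsRational (R : Set Space) : Prop :=
  ∃ l : List ℤ, AmbientIsotopicRel openBoxᶜ (contFrac l) R

/-- Connectivity type `[0]`: NW is connected to NE and SW to SE. -/
def ConnectivityZero (R : Set Space) : Prop := JoinedIn R NW NE ∧ JoinedIn R SW SE

/-- Connectivity type `[∞]`: NW is connected to SW and NE to SE. -/
def ConnectivityInfty (R : Set Space) : Prop := JoinedIn R NW SW ∧ JoinedIn R NE SE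

/-- Connectivity type `[1]`: NW is connected to SE and SW to NE. -/
def ConnectivityOne (R : Set Space) : Prop := JoinedIn R NW SE ∧ JoinedIn R SW NE

/-- The solid torus closure. The box is embedded in the solid torus by
`(x, y, z) ↦ (exp (i y), x, z)`, so that `y` runs along the core, `x` is the radial direction of
the annulus and `z` is the height. The two north ends are joined to the two south ends by parallel
arcs going around the annulus outside the box. -/
def closure (T : Set Space) : Set SolidTorus :=
  {p | (∃ v ∈ T, p.1 = Circle.exp v.2.1 ∧ (p.2 : ℝ × ℝ) = (v.1, v.2.2)) ∨
    ∃ t ∈ Set.Icc 1 (2 * Real.pi - 1), p.1 = Circle.exp t ∧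
      ((p.2 : ℝ × ℝ) = (-1, 0) ∨ (p.2 : ℝ × ℝ) = (1, 0))}

end Tangle

namespace SolidTorusLink

/-- `f` is a parametrization of `L` as a link with `n` components. -/
def IsParam {n : ℕ} (f : C(Fin n × Circle, SolidTorus)) (L : Set SolidTorus) : Prop :=
  Topology.IsEmbedding f ∧ Set.range f = L

/-- `L` is a link with `n` components. -/
def IsLink (n : ℕ) (L : Set SolidTorus) : Prop :=
  ∃ f : C(Fin n × Circle, SolidTorus), IsParam f L

/-- A knot is a link with one component. -/
def IsKnot (L : Set SolidTorus) : Prop := IsLink 1 L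

/-- `L` and `L'` are links of the same homotopy type: suitable parametrizations by the same
disjoint union of circles are homotopic maps into the solid torus (during the homotopy, strands
may pass through each other). -/
def SameHomotopyType (L L' : Set SolidTorus) : Prop :=
  ∃ (n : ℕ) (f f' : C(Fin n × Circle, SolidTorus)),
    IsParam f L ∧ IsParam f' L' ∧ f.Homotopic f'

/-- Two parallel copies of the core circle. -/
def twoCores : Set SolidTorus :=
  {p | (p.2 : ℝ × ℝ) = (-1, 0) ∨ (p.2 : ℝ × ℝ) = (1, 0)}

/-- The trivial knot: a small circle in the annulus that bounds a disc there. -/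
noncomputable def trivialKnot : Set SolidTorus :=
  {p | ∃ t : ℝ, p.1 = Circle.exp (Real.cos t) ∧ (p.2 : ℝ × ℝ) = (Real.sin t, 0)}

/-- The crossing knot: it goes twice around the solid torus, and its projection to the annulus
has exactly one crossing. -/
noncomputable def crossingKnot : Set SolidTorus :=
  {p | ∃ t : ℝ, p.1 = Circle.exp (2 * t) ∧ (p.2 : ℝ × ℝ) = (Real.cos t, Real.sin t)}

/-- `L` is a rational link in the solid torus with underlying rational tangle `R`: it is, up to
ambient isotopy of the solid torus, the solid torus closure of `R`. -/
def IsRationalWith (R : Set Space) (L : Set SolidTorus) : Prop :=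
  Tangle.IsRational R ∧ AmbientIsotopicRel ∅ (Tangle.closure R) L

end SolidTorusLink

/-! A rational tangle consists of two disjoint arcs in the box that join the four corners in pairs,
and there are only three such pairings. This goes by induction on the continued fraction: `[0]` and
`[1]` are explicit, mirror images and diagonal reflections permute the pairings, and in a sum the
arcs are glued at common ends (`HasType.sum`). The one danger is a closed component in the middle of
a sum. It cannot arise, since the left summand is always an integer tangle, which never has type
`[∞]`. An isotopy fixing everything outside the open box preserves the pairing.

In the closure, the two arcs and the two outer arcs are lifted to the strip that covers the solid
torus. Following them around shows two loops of winding number 1 for type `[∞]`, one loop of winding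
number 0 for type `[0]`, and one loop of winding number 2 for type `[1]`. The cross section of the
solid torus is convex, so maps of circles with equal winding numbers are homotopic
(`WindsBy.homotopic`), and the three model links have the required winding numbers. The ambient
isotopy that leads to the given link is itself a homotopy of parametrizations
(`IsWindingLink.conclusion`). -/

open Function Set

/-! ### Arcs seen through a projection `q`: with `id` they are arcs in space, with `cover` arcs in
the solid torus that remember their lifts. -/

section Arcs

variable {E X Y : Type*} [TopologicalSpace E]

/-- `A` is the injective image under `q` of a path from `a` to `b`. -/
def IsArcOver (q : E → X) (A : Set X) (a b : E) : Prop :=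
  ∃ γ : Path a b, Injective (q ∘ γ) ∧ range (q ∘ γ) = A

namespace IsArcOver

variable {q : E → X} {A B : Set X} {a b c : E}

theorem symm (h : IsArcOver q A a b) : IsArcOver q A b a := by
  obtain ⟨γ, hi, hr⟩ := h
  refine ⟨γ.symm, fun s t hst => ?_, ?_⟩
  · exact unitInterval.symm_bijective.injective (hi hst)
  · rw [← hr]
    exact unitInterval.symm_bijective.surjective.range_comp (q ∘ γ)

theorem left_mem (h : IsArcOver q A a b) : q a ∈ A := by
  obtain ⟨γ, -, rfl⟩ := h
  exact ⟨0, by simp⟩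

theorem right_mem (h : IsArcOver q A a b) : q b ∈ A := h.symm.left_mem

theorem range_comp_trans (γ : Path a b) (γ' : Path b c) :
    range (q ∘ γ.trans γ') = range (q ∘ γ) ∪ range (q ∘ γ') := by
  rw [range_comp, range_comp, range_comp, Path.trans_range, image_union]

theorem trans (h : IsArcOver q A a b) (h' : IsArcOver q B b c) (hAB : A ∩ B ⊆ {q b}) :
    IsArcOver q (A ∪ B) a c := by
  obtain ⟨γ, hi, rfl⟩ := h
  obtain ⟨γ', hi', rfl⟩ := h'
  have key : ∀ s t : unitInterval, (s : ℝ) ≤ 1 / 2 → ¬ (t : ℝ) ≤ 1 / 2 →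
      q (γ.trans γ' s) ≠ q (γ.trans γ' t) := by
    intro s t hs ht hst
    rw [Path.trans_apply, Path.trans_apply, dif_pos hs, dif_neg ht] at hst
    -- The common point is `q b`, which the second path visits only at parameter 0, that is at `t =
    -- 1 / 2`, against `ht`.
    have h1 := hAB ⟨⟨_, hst⟩, ⟨_, rfl⟩⟩
    have h2 := hi' (a₁ := _) (a₂ := 0) (by simpa using h1)
    have h3 := congrArg Subtype.val h2
    simp only [Icc.coe_zero] at h3
    linarith
  refine ⟨γ.trans γ', fun s t hst => ?_, range_comp_trans γ γ'⟩
  by_cases hs : (s : ℝ) ≤ 1 / 2 <;> by_cases ht : (t : ℝ) ≤ 1 / 2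
  · simp only [comp_apply, Path.trans_apply, dif_pos hs, dif_pos ht] at hst
    have := congrArg Subtype.val (hi hst)
    exact Subtype.ext (by simpa using this)
  · exact absurd hst (key s t hs ht)
  · exact absurd hst.symm (key t s ht hs)
  · simp only [comp_apply, Path.trans_apply, dif_neg hs, dif_neg ht] at hst
    have := congrArg Subtype.val (hi' hst)
    exact Subtype.ext (by simpa using this)

/-- Two arcs with common ends (after projection) form a loop. -/
theorem exists_loop (h : IsArcOver q A a b) (h' : IsArcOver q B b c)
    (hAB : A ∩ B ⊆ {q a, q b}) (hac : q c = q a) :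
    ∃ γ : Path a c, (∀ s t : unitInterval, s < 1 → t < 1 → q (γ s) = q (γ t) → s = t) ∧
      range (q ∘ γ) = A ∪ B := by
  obtain ⟨γ, hi, rfl⟩ := h
  obtain ⟨γ', hi', rfl⟩ := h'
  have key : ∀ s t : unitInterval, (s : ℝ) ≤ 1 / 2 → ¬ (t : ℝ) ≤ 1 / 2 → t < 1 →
      q (γ.trans γ' s) ≠ q (γ.trans γ' t) := by
    intro s t hs ht ht1 hst
    have ht1' : (t : ℝ) < 1 := ht1
    rw [Path.trans_apply, Path.trans_apply, dif_pos hs, dif_neg ht] at hst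
    -- The second path meets `q a = q c` only at its end, excluded by `t < 1`, and `q b` only at its
    -- start, excluded by `ht`.
    rcases hAB ⟨⟨_, hst⟩, ⟨_, rfl⟩⟩ with h1 | h1
    · have h2 := hi' (a₁ := _) (a₂ := 1) (by simpa [hac] using h1)
      have h3 := congrArg Subtype.val h2
      simp only [Icc.coe_one] at h3
      linarith
    · have h2 := hi' (a₁ := _) (a₂ := 0) (by simpa using h1)
      have h3 := congrArg Subtype.val h2
      simp only [Icc.coe_zero] at h3
      linarith
  refine ⟨γ.trans γ', fun s t hs1 ht1 hst => ?_, range_comp_trans γ γ'⟩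
  by_cases hs : (s : ℝ) ≤ 1 / 2 <;> by_cases ht : (t : ℝ) ≤ 1 / 2
  · simp only [Path.trans_apply, dif_pos hs, dif_pos ht] at hst
    have := congrArg Subtype.val (hi hst)
    exact Subtype.ext (by simpa using this)
  · exact absurd hst (key s t hs ht ht1)
  · exact absurd hst.symm (key t s ht hs hs1)
  · simp only [Path.trans_apply, dif_neg hs, dif_neg ht] at hst
    have := congrArg Subtype.val (hi' hst)
    exact Subtype.ext (by simpa using this)

/-- Arcs are carried to arcs by maps that are injective on them. -/
theorem comp {r : X → Y} (h : IsArcOver q A a b) (hr : InjOn r A) :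
    IsArcOver (r ∘ q) (r '' A) a b := by
  obtain ⟨γ, hi, rfl⟩ := h
  refine ⟨γ, fun s t hst => hi (hr (mem_range_self s) (mem_range_self t) hst), ?_⟩
  rw [comp_assoc, range_comp r]

theorem map {F : Type*} [TopologicalSpace F] {A : Set E} {r : E → F} (h : IsArcOver id A a b)
    (hc : Continuous r) (hr : InjOn r A) : IsArcOver id (r '' A) (r a) (r b) := by
  obtain ⟨γ, hi, rfl⟩ := h
  refine ⟨γ.map hc, fun s t hst => hi (hr (mem_range_self s) (mem_range_self t) hst), ?_⟩
  rw [id_comp, id_comp, ← range_comp]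
  rfl

theorem joinedIn {A T : Set E} (h : IsArcOver id A a b) (hA : A ⊆ T) : JoinedIn T a b := by
  obtain ⟨γ, -, rfl⟩ := h
  exact ⟨γ, fun t => hA ⟨t, rfl⟩⟩

/-- Arcs are carried to arcs by deck transformations. -/
theorem deck {g : E → E} (h : IsArcOver q A a b) (hc : Continuous g) (hq : ∀ e, q (g e) = q e) :
    IsArcOver q A (g a) (g b) := by
  obtain ⟨γ, hi, rfl⟩ := h
  have : q ∘ γ.map hc = q ∘ γ := funext fun t => hq _
  exact ⟨γ.map hc, this ▸ hi, this ▸ rfl⟩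

end IsArcOver

theorem isArcOver_segment {F : Type*} [AddCommGroup F] [Module ℝ F] [TopologicalSpace F]
    [ContinuousAdd F] [ContinuousSMul ℝ F] {a b : F} (hab : a ≠ b) :
    IsArcOver id (segment ℝ a b) a b := by
  refine ⟨⟨⟨fun t => (1 - (t : ℝ)) • a + (t : ℝ) • b, by fun_prop⟩, by simp, by simp⟩, ?_, ?_⟩
  · intro s t hst
    have h1 : (1 - (s : ℝ)) • a + (s : ℝ) • b = (1 - (t : ℝ)) • a + (t : ℝ) • b := hst
    have h2 : ((s : ℝ) - t) • (b - a) = 0 := by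
      rw [← sub_eq_zero] at h1
      rw [← h1]; module
    rcases smul_eq_zero.1 h2 with h | h
    · exact Subtype.ext (sub_eq_zero.1 h)
    · exact absurd (sub_eq_zero.1 h).symm hab
  · rw [segment_eq_image]
    ext x
    simp only [mem_range, mem_image, id_comp]
    exact ⟨fun ⟨t, ht⟩ => ⟨t, t.2, ht⟩, fun ⟨t, h, ht⟩ => ⟨⟨t, h⟩, ht⟩⟩

end Arcs

/-! ### Pairs of arcs and the three pairings of four points. -/

section Pairings

variable {E F : Type*} [TopologicalSpace E] [TopologicalSpace F] {P Q : Set E}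
  {a b c d n s p₁ p₂ q₁ q₂ : E}

/-- `T` is the union of two disjoint arcs, from `a` to `b` and from `c` to `d`. -/
def IsArcPair (T : Set E) (a b c d : E) : Prop :=
  ∃ A B : Set E, IsArcOver id A a b ∧ IsArcOver id B c d ∧ Disjoint A B ∧ A ∪ B = T

namespace IsArcPair

theorem swap (h : IsArcPair P a b c d) : IsArcPair P c d a b := by
  obtain ⟨A, B, hA, hB, hd, rfl⟩ := h
  exact ⟨B, A, hB, hA, hd.symm, union_comm _ _⟩

theorem reverse (h : IsArcPair P a b c d) : IsArcPair P b a d c := by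
  obtain ⟨A, B, hA, hB, hd, rfl⟩ := h
  exact ⟨A, B, hA.symm, hB.symm, hd, rfl⟩

theorem reverse_right (h : IsArcPair P a b c d) : IsArcPair P a b d c := by
  obtain ⟨A, B, hA, hB, hd, rfl⟩ := h
  exact ⟨A, B, hA, hB.symm, hd, rfl⟩

theorem map {r : E → F} (h : IsArcPair P a b c d) (hc : Continuous r) (hr : Injective r) :
    IsArcPair (r '' P) (r a) (r b) (r c) (r d) := by
  obtain ⟨A, B, hA, hB, hd, rfl⟩ := h
  exact ⟨r '' A, r '' B, hA.map hc hr.injOn, hB.map hc hr.injOn,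
    (disjoint_image_iff hr).2 hd, (image_union r A B).symm⟩

/-- Each arc of `P` is continued by its own arc of `Q`. The two results stay disjoint because `n`
and `s` lie on different arcs on both sides. -/
theorem glue_through (hP : IsArcPair P p₁ n p₂ s) (hQ : IsArcPair Q n q₁ s q₂)
    (hPQ : P ∩ Q ⊆ {n, s}) : IsArcPair (P ∪ Q) p₁ q₁ p₂ q₂ := by
  obtain ⟨A, A', hA, hA', hd, rfl⟩ := hP
  obtain ⟨B, B', hB, hB', hd', rfl⟩ := hQ
  have hnA : n ∈ A := hA.right_mem
  have hsA : s ∈ A' := hA'.right_mem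
  have hnB : n ∈ B := hB.left_mem
  have hsB : s ∈ B' := hB'.left_mem
  rw [disjoint_left] at hd hd'
  have key : ∀ x, x ∈ A ∪ A' → x ∈ B ∪ B' → x = n ∨ x = s := fun x h h' => hPQ ⟨h, h'⟩
  refine ⟨A ∪ B, A' ∪ B', hA.trans hB ?_, hA'.trans hB' ?_, ?_, ?_⟩
  · rintro x ⟨h, h'⟩
    rcases key x (.inl h) (.inl h') with rfl | rfl
    · rfl
    · exact absurd hsA (hd h)
  · rintro x ⟨h, h'⟩
    rcases key x (.inr h) (.inr h') with rfl | rfl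
    · exact absurd h (hd hnA)
    · rfl
  · rw [disjoint_left]
    rintro x (h | h) (h' | h')
    · exact hd h h'
    · rcases key x (.inl h) (.inr h') with rfl | rfl
      · exact hd' hnB h'
      · exact hd h hsA
    · rcases key x (.inr h') (.inl h) with rfl | rfl
      · exact hd hnA h'
      · exact hd' h hsB
    · exact hd' h h'
  · exact union_union_union_comm A B A' B'

/-- One arc of `Q` joins `n` to `s` and so links the arcs of `P` into a single one, which returns to
the side it came from. The other arc of `Q` is left untouched. -/
theorem glue_return (hP : IsArcPair P p₁ n p₂ s) (hQ : IsArcPair Q n s q₁ q₂)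
    (hPQ : P ∩ Q ⊆ {n, s}) : IsArcPair (P ∪ Q) p₁ p₂ q₁ q₂ := by
  obtain ⟨A, A', hA, hA', hd, rfl⟩ := hP
  obtain ⟨B, B', hB, hB', hd', rfl⟩ := hQ
  have hnA : n ∈ A := hA.right_mem
  have hsA : s ∈ A' := hA'.right_mem
  have hnB : n ∈ B := hB.left_mem
  have hsB : s ∈ B := hB.right_mem
  rw [disjoint_left] at hd hd'
  have key : ∀ x, x ∈ A ∪ A' → x ∈ B ∪ B' → x = n ∨ x = s := fun x h h' => hPQ ⟨h, h'⟩
  have key' : ∀ x, x ∈ A ∪ A' → x ∉ B' := fun x h h' => by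
    rcases key x h (.inr h') with rfl | rfl
    · exact hd' hnB h'
    · exact hd' hsB h'
  refine ⟨(A ∪ B) ∪ A', B', (hA.trans hB ?_).trans hA'.symm ?_, hB', ?_, ?_⟩
  · rintro x ⟨h, h'⟩
    rcases key x (.inl h) (.inl h') with rfl | rfl
    · rfl
    · exact absurd hsA (hd h)
  · rintro x ⟨h | h, h'⟩
    · exact absurd h' (hd h)
    · rcases key x (.inr h') (.inl h) with rfl | rfl
      · exact absurd h' (hd hnA)
      · rfl
  · rw [disjoint_left]
    rintro x ((h | h) | h) h'
    · exact key' x (.inl h) h'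
    · exact hd' h h'
    · exact key' x (.inr h) h'
  · ext x; simp only [mem_union]; tauto

end IsArcPair

/-- The three ways to connect four points in pairs. -/
inductive Connectivity
  | zero
  | infty
  | one

/-- The effect on the connectivity type of exchanging the two left points. -/
def Connectivity.twist : Connectivity → Connectivity
  | zero => one
  | infty => infty
  | one => zero

/-- The effect on the connectivity type of the reflection in the diagonal. -/
def Connectivity.inv : Connectivity → Connectivity
  | zero => infty
  | infty => zero
  | one => one

/-- `T` consists of two disjoint arcs that connect the four points as the type `τ` says. -/
def Connects (T : Set E) (nw ne sw se : E) : Connectivity → Prop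
  | .zero => IsArcPair T nw ne sw se
  | .infty => IsArcPair T nw sw ne se
  | .one => IsArcPair T nw se sw ne

namespace Connects

variable {τ : Connectivity}

theorem map {r : E → F} (h : Connects P a b c d τ) (hc : Continuous r) (hr : Injective r) :
    Connects (r '' P) (r a) (r b) (r c) (r d) τ := by
  cases τ <;> exact IsArcPair.map h hc hr

theorem reflect (h : Connects P a b c d τ) : Connects P b a d c τ := by
  cases τ
  · exact h.reverse
  · exact h.swap
  · exact h.swap.reverse

theorem twist (h : Connects P a b c d τ) : Connects P c b a d τ.twist := by
  cases τ
  · exact IsArcPair.swap h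
  · exact (IsArcPair.reverse h).reverse_right
  · exact IsArcPair.swap h

theorem transpose (h : Connects P a b c d τ) : Connects P a c b d τ.inv := by
  cases τ
  · exact h
  · exact h
  · exact h.reverse_right

/-- Two strands attached on the left only prolong the arcs of `Q`, whichever way these run. -/
theorem glue (hP : IsArcPair P p₁ n p₂ s) (hQ : Connects Q n q₁ s q₂ τ)
    (hPQ : P ∩ Q ⊆ {n, s}) : Connects (P ∪ Q) p₁ q₁ p₂ q₂ τ := by
  cases τ
  · exact hP.glue_through hQ hPQ
  · exact hP.glue_return hQ hPQ
  · exact hP.glue_through hQ hPQ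

theorem glue_right (hQ : Connects Q q₁ n q₂ s τ) (hP : IsArcPair P n p₁ s p₂)
    (hQP : Q ∩ P ⊆ {n, s}) : Connects (Q ∪ P) q₁ p₁ q₂ p₂ τ := by
  rw [inter_comm] at hQP
  rw [union_comm]
  exact (glue hP.reverse hQ.reflect hQP).reflect

end Connects

end Pairings

/-! ### The connectivity type of the basic tangles, mirror images and reflections. -/

namespace Tangle

/-- The four corners of the projection square. -/
def corners : Set Space := {NW, NE, SW, SE}

/-- `T` consists of two disjoint arcs in the open box, apart from their end points, the four
corners, which they connect as the type `τ` says. -/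
structure HasType (T : Set Space) (τ : Connectivity) : Prop where
  connects : Connects T NW NE SW SE τ
  subset : T ⊆ openBox ∪ corners

theorem mem_box {v : Space} (hv : v ∈ openBox ∪ corners) :
    |v.1| ≤ 1 ∧ |v.2.1| ≤ 1 ∧ |v.2.2| ≤ 1 := by
  rcases hv with ⟨h1, h2, h3⟩ | rfl | rfl | rfl | rfl
  · exact ⟨h1.le, h2.le, h3.le⟩
  all_goals norm_num [NW, NE, SW, SE]

theorem eq_of_fst_eq_neg_one {v : Space} (hv : v ∈ openBox ∪ corners) (h : v.1 = -1) :
    v = NW ∨ v = SW := by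
  rcases hv with ⟨h1, h2, h3⟩ | rfl | rfl | rfl | rfl
  · rw [h] at h1; norm_num at h1
  · exact .inl rfl
  · norm_num [NE] at h
  · exact .inr rfl
  · norm_num [SE] at h

theorem eq_of_fst_eq_one {v : Space} (hv : v ∈ openBox ∪ corners) (h : v.1 = 1) :
    v = NE ∨ v = SE := by
  rcases hv with ⟨h1, h2, h3⟩ | rfl | rfl | rfl | rfl
  · rw [h] at h1; norm_num at h1
  · norm_num [NW] at h
  · exact .inl rfl
  · norm_num [SW] at h
  · exact .inr rfl

theorem mem_segment {a b v : Space} (h : v ∈ segment ℝ a b) :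
    ∃ t : ℝ, 0 ≤ t ∧ t ≤ 1 ∧ v.1 = (1 - t) * a.1 + t * b.1 ∧
      v.2.1 = (1 - t) * a.2.1 + t * b.2.1 ∧ v.2.2 = (1 - t) * a.2.2 + t * b.2.2 := by
  rw [segment_eq_image] at h
  obtain ⟨t, ht, rfl⟩ := h
  exact ⟨t, ht.1, ht.2, by simp, by simp, by simp⟩

/-- A segment from a point of the open box to a corner. -/
theorem segment_subset {a b : Space} (ha : a ∈ openBox) (hb : b ∈ corners) :
    segment ℝ a b ⊆ openBox ∪ corners := by
  have hb1 := mem_box (.inr hb)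
  intro v hv
  rw [segment_eq_image] at hv
  obtain ⟨t, ht, rfl⟩ := hv
  rcases eq_or_lt_of_le ht.2 with rfl | h1
  · right; simpa using hb
  · left
    have key : ∀ x y : ℝ, |x| < 1 → |y| ≤ 1 → |(1 - t) * x + t * y| < 1 := by
      intro x y hx hy
      rw [abs_lt] at hx ⊢
      rw [abs_le] at hy
      constructor <;> nlinarith [ht.1]
    exact ⟨key _ _ ha.1 hb1.1, key _ _ ha.2.1 hb1.2.1, key _ _ ha.2.2 hb1.2.2⟩

theorem segment_fst_left {a b v : Space} (h : v ∈ segment ℝ a b) (hab : a.1 < b.1) :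
    a.1 ≤ v.1 ∧ (v.1 ≤ a.1 → v = a) := by
  rw [segment_eq_image] at h
  obtain ⟨t, ht, rfl⟩ := h
  simp only [Prod.fst_add, Prod.smul_fst, smul_eq_mul]
  refine ⟨by nlinarith [ht.1], fun h => ?_⟩
  have : t = 0 := by nlinarith [ht.1]
  simp [this]

theorem segment_fst_right {a b v : Space} (h : v ∈ segment ℝ a b) (hab : a.1 < b.1) :
    v.1 ≤ b.1 ∧ (b.1 ≤ v.1 → v = b) := by
  rw [segment_eq_image] at h
  obtain ⟨t, ht, rfl⟩ := h
  simp only [Prod.fst_add, Prod.smul_fst, smul_eq_mul]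
  refine ⟨by nlinarith [ht.2], fun h => ?_⟩
  have : t = 1 := by nlinarith [ht.2]
  simp [this]

/-- A bent strand that runs from left to right. -/
theorem isArcOver_bent {a m b : Space} (ha : a.1 < m.1) (hb : m.1 < b.1) :
    IsArcOver id (segment ℝ a m ∪ segment ℝ m b) a b :=
  (isArcOver_segment fun h => ha.ne (congrArg _ h)).trans
    (isArcOver_segment fun h => hb.ne (congrArg _ h)) fun _ hv =>
      (segment_fst_right hv.1 ha).2 (segment_fst_left hv.2 hb).1

theorem hasType_zero : HasType zero .zero := by
  refine ⟨⟨_, _, isArcOver_bent ?_ ?_,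
    isArcOver_bent ?_ ?_, ?_, rfl⟩, ?_⟩
  any_goals norm_num [NW, NE, SW, SE]
  · refine ⟨⟨?_, ?_⟩, ⟨?_, ?_⟩⟩ <;>
    · rw [disjoint_left]
      intro v h h'
      obtain ⟨s, hs0, hs1, hs2, hs3, hs4⟩ := mem_segment h
      obtain ⟨t, ht0, ht1, ht2, ht3, ht4⟩ := mem_segment h'
      norm_num at *
      linarith
  · refine union_subset (union_subset ?_ ?_) (union_subset ?_ ?_)
    · rw [segment_symm]
      exact segment_subset (by norm_num [openBox]) (by simp [corners])
    · exact segment_subset (by norm_num [openBox]) (by simp [corners])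
    · rw [segment_symm]
      exact segment_subset (by norm_num [openBox, abs_lt]) (by simp [corners])
    · exact segment_subset (by norm_num [openBox, abs_lt]) (by simp [corners])

theorem hasType_one : HasType one .one := by
  refine ⟨IsArcPair.swap ⟨_, _, isArcOver_bent ?_ ?_,
    isArcOver_bent ?_ ?_, ?_, rfl⟩, ?_⟩
  any_goals norm_num [NW, NE, SW, SE]
  · refine ⟨⟨?_, ?_⟩, ⟨?_, ?_⟩⟩ <;>
    · rw [disjoint_left]
      intro v h h'
      obtain ⟨s, hs0, hs1, hs2, hs3, hs4⟩ := mem_segment h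
      obtain ⟨t, ht0, ht1, ht2, ht3, ht4⟩ := mem_segment h'
      norm_num at *
      linarith
  · refine union_subset (union_subset ?_ ?_) (union_subset ?_ ?_)
    · rw [segment_symm]
      exact segment_subset (by norm_num [openBox, abs_lt]) (by simp [corners])
    · exact segment_subset (by norm_num [openBox, abs_lt]) (by simp [corners])
    · rw [segment_symm]
      exact segment_subset (by norm_num [openBox, abs_lt]) (by simp [corners])
    · exact segment_subset (by norm_num [openBox, abs_lt]) (by simp [corners])

theorem HasType.neg {T : Set Space} {τ : Connectivity} (h : HasType T τ) :
    HasType (neg T) τ := by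
  constructor
  · have := h.connects.map (r := fun v : Space => ((v.1, v.2.1, -v.2.2) : Space)) (by fun_prop)
      (fun v w hvw => by
        simp only [Prod.mk.injEq, neg_inj] at hvw
        exact Prod.ext hvw.1 (Prod.ext hvw.2.1 hvw.2.2))
    norm_num [NW, NE, SW, SE] at this ⊢
    exact this
  · rintro _ ⟨v, hv, rfl⟩
    rcases h.subset hv with hv | rfl | rfl | rfl | rfl
    · left; simpa [openBox] using hv
    all_goals right; simp [corners, NW, NE, SW, SE]

theorem HasType.inv {T : Set Space} {τ : Connectivity} (h : HasType T τ) :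
    HasType (inv T) τ.inv := by
  constructor
  · have := h.connects.map (r := fun v : Space => ((-v.2.1, -v.1, v.2.2) : Space)) (by fun_prop)
      (fun v w hvw => by
        simp only [Prod.mk.injEq, neg_inj] at hvw
        exact Prod.ext hvw.2.1 (Prod.ext hvw.1 hvw.2.2))
    -- The reflection fixes NW and SE and interchanges NE and SW, so the corners have to be put back
    -- in order.
    replace this := this.transpose
    norm_num [NW, NE, SW, SE] at this ⊢
    exact this
  · rintro _ ⟨v, hv, rfl⟩
    rcases h.subset hv with hv | rfl | rfl | rfl | rfl
    · left
      simp only [openBox, mem_ofPred_eq, abs_neg] at hv ⊢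
      exact ⟨hv.2.1, hv.1, hv.2.2⟩
    all_goals right; simp [corners, NW, NE, SW, SE]

/-! ### Sums, and the induction over continued fractions. -/

theorem shrink_injective (c : ℝ) : Injective (shrink c) := fun v w h => by
  simp only [shrink, Prod.mk.injEq] at h
  exact Prod.ext (by linarith [h.1]) (Prod.ext (by linarith [h.2.1]) (by linarith [h.2.2]))

theorem continuous_shrink (c : ℝ) : Continuous (shrink c) := by
  unfold shrink; fun_prop

theorem shrink_fst {c : ℝ} {v : Space} (hv : v ∈ openBox ∪ corners) :
    c - 1 / 4 ≤ (shrink c v).1 ∧ (shrink c v).1 ≤ c + 1 / 4 := by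
  have := abs_le.1 (mem_box hv).1
  simp only [shrink]
  constructor <;> linarith

/-- Two strands that are separated by the plane `y = 0`. -/
theorem isArcPair_strands {a b c d : Space} (hab : a.1 < b.1) (hcd : c.1 < d.1)
    (ha : 0 < a.2.1) (hb : 0 < b.2.1) (hc : c.2.1 < 0) (hd : d.2.1 < 0) :
    IsArcPair (segment ℝ a b ∪ segment ℝ c d) a b c d := by
  refine ⟨_, _, isArcOver_segment fun h => ?_, isArcOver_segment fun h => ?_, ?_, rfl⟩
  · rw [h] at hab; exact lt_irrefl _ hab
  · rw [h] at hcd; exact lt_irrefl _ hcd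
  · rw [disjoint_left]
    intro v h h'
    obtain ⟨s, hs0, hs1, -, hs, -⟩ := mem_segment h
    obtain ⟨t, ht0, ht1, -, ht, -⟩ := mem_segment h'
    have h1 : 0 < v.2.1 := by
      rw [hs]
      rcases eq_or_lt_of_le hs0 with rfl | h0
      · simpa using ha
      · nlinarith [mul_pos h0 hb]
    have h2 : v.2.1 < 0 := by
      rw [ht]
      rcases eq_or_lt_of_le ht0 with rfl | h0
      · simpa using hc
      · nlinarith [mul_pos h0 (neg_pos.2 hd)]
    exact lt_asymm h1 h2

theorem strands_fst_left {a b c d v : Space} (h : v ∈ segment ℝ a b ∪ segment ℝ c d)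
    (hab : a.1 < b.1) (hcd : c.1 < d.1) (hac : a.1 = c.1) :
    a.1 ≤ v.1 ∧ (v.1 ≤ a.1 → v = a ∨ v = c) := by
  rcases h with h | h
  · have := segment_fst_left h hab
    exact ⟨this.1, fun h => .inl (this.2 h)⟩
  · have := segment_fst_left h hcd
    rw [hac]
    exact ⟨this.1, fun h => .inr (this.2 h)⟩

theorem strands_fst_right {a b c d v : Space} (h : v ∈ segment ℝ a b ∪ segment ℝ c d)
    (hab : a.1 < b.1) (hcd : c.1 < d.1) (hbd : b.1 = d.1) :
    v.1 ≤ b.1 ∧ (b.1 ≤ v.1 → v = b ∨ v = d) := by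
  rcases h with h | h
  · have := segment_fst_right h hab
    exact ⟨this.1, fun h => .inl (this.2 h)⟩
  · have := segment_fst_right h hcd
    rw [hbd]
    exact ⟨this.1, fun h => .inr (this.2 h)⟩

theorem shrink_subset_openBox {T : Set Space} {c : ℝ} (hT : T ⊆ openBox ∪ corners)
    (hc : |c| ≤ 1 / 2) : shrink c '' T ⊆ openBox := by
  rintro _ ⟨v, hv, rfl⟩
  obtain ⟨h1, h2, h3⟩ := mem_box (hT hv)
  rw [abs_le] at *
  simp only [shrink, openBox, mem_ofPred_eq, abs_lt]
  refine ⟨⟨?_, ?_⟩, ⟨?_, ?_⟩, ⟨?_, ?_⟩⟩ <;> linarith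

/-- The type of the sum of two tangles, the first of type `[0]` or `[1]`. -/
def sumType (τ : Connectivity) : Connectivity → Connectivity
  | .one => τ.twist
  | _ => τ

/-- The planes `x = -3/4, -1/4, 1/4, 3/4` cut the sum into left strands, `S`, middle strands, `T`
and right strands. Neighbouring pieces meet only in the two ends on the common plane, and they are
glued from right to left. If both summands had type `[∞]`, the middle strands would close up to a
circle; `hσ` rules this out. -/
theorem HasType.sum {S T : Set Space} {σ τ : Connectivity} (hS : HasType S σ) (hT : HasType T τ)
    (hσ : σ ≠ .infty) : HasType (sum S T) (sumType τ σ) := by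
  have e : Tangle.sum S T =
      (segment ℝ NW (shrink (-1 / 2) NW) ∪ segment ℝ SW (shrink (-1 / 2) SW)) ∪
      (shrink (-1 / 2) '' S ∪
      ((segment ℝ (shrink (-1 / 2) NE) (shrink (1 / 2) NW) ∪
        segment ℝ (shrink (-1 / 2) SE) (shrink (1 / 2) SW)) ∪
      (shrink (1 / 2) '' T ∪
      (segment ℝ (shrink (1 / 2) NE) NE ∪ segment ℝ (shrink (1 / 2) SE) SE)))) := by
    ext v; simp only [Tangle.sum, mem_union]; tauto
  constructor
  · have hr := isArcPair_strands (a := shrink (1 / 2) NE) (b := NE) (c := shrink (1 / 2) SE)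
      (d := SE) (by norm_num [shrink, NE]) (by norm_num [shrink, SE]) (by norm_num [shrink, NE])
      (by norm_num [NE]) (by norm_num [shrink, SE]) (by norm_num [SE])
    have hm := isArcPair_strands (a := shrink (-1 / 2) NE) (b := shrink (1 / 2) NW)
      (c := shrink (-1 / 2) SE) (d := shrink (1 / 2) SW) (by norm_num [shrink, NE, NW])
      (by norm_num [shrink, SE, SW]) (by norm_num [shrink, NE]) (by norm_num [shrink, NW])
      (by norm_num [shrink, SE]) (by norm_num [shrink, SW])
    have hl := isArcPair_strands (a := NW) (b := shrink (-1 / 2) NW) (c := SW)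
      (d := shrink (-1 / 2) SW) (by norm_num [shrink, NW]) (by norm_num [shrink, SW])
      (by norm_num [NW]) (by norm_num [shrink, NW]) (by norm_num [SW]) (by norm_num [shrink, SW])
    set l := segment ℝ NW (shrink (-1 / 2) NW) ∪ segment ℝ SW (shrink (-1 / 2) SW) with hl'
    set m := segment ℝ (shrink (-1 / 2) NE) (shrink (1 / 2) NW) ∪
        segment ℝ (shrink (-1 / 2) SE) (shrink (1 / 2) SW) with hm'
    set r := segment ℝ (shrink (1 / 2) NE) NE ∪ segment ℝ (shrink (1 / 2) SE) SE with hr'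
    have xl : ∀ v ∈ l, v.1 ≤ -3 / 4 ∧
        (-3 / 4 ≤ v.1 → v = shrink (-1 / 2) NW ∨ v = shrink (-1 / 2) SW) := fun v hv => by
      convert strands_fst_right hv (by norm_num [shrink, NW]) (by norm_num [shrink, SW])
        (by norm_num [shrink, NW, SW]) using 2 <;> norm_num [shrink, NW]
    have xm : ∀ v ∈ m, v.1 ≤ 1 / 4 ∧
        (1 / 4 ≤ v.1 → v = shrink (1 / 2) NW ∨ v = shrink (1 / 2) SW) := fun v hv => by
      convert strands_fst_right hv (by norm_num [shrink, NW, NE]) (by norm_num [shrink, SW, SE])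
        (by norm_num [shrink, NW, SW]) using 2 <;> norm_num [shrink, NW]
    have xm' : ∀ v ∈ m, -1 / 4 ≤ v.1 ∧
        (v.1 ≤ -1 / 4 → v = shrink (-1 / 2) NE ∨ v = shrink (-1 / 2) SE) := fun v hv => by
      convert strands_fst_left hv (by norm_num [shrink, NW, NE]) (by norm_num [shrink, SW, SE])
        (by norm_num [shrink, NE, SE]) using 2 <;> norm_num [shrink, NE]
    have xr : ∀ v ∈ r, 3 / 4 ≤ v.1 ∧
        (v.1 ≤ 3 / 4 → v = shrink (1 / 2) NE ∨ v = shrink (1 / 2) SE) := fun v hv => by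
      convert strands_fst_left hv (by norm_num [shrink, NE]) (by norm_num [shrink, SE])
        (by norm_num [shrink, NE, SE]) using 2 <;> norm_num [shrink, NE]
    have xS : ∀ v ∈ shrink (-1 / 2) '' S, -3 / 4 ≤ v.1 ∧ v.1 ≤ -1 / 4 := by
      rintro _ ⟨v, hv, rfl⟩
      have := shrink_fst (c := -1 / 2) (hS.subset hv)
      constructor <;> linarith
    have xT : ∀ v ∈ shrink (1 / 2) '' T, 1 / 4 ≤ v.1 ∧ v.1 ≤ 3 / 4 := by
      rintro _ ⟨v, hv, rfl⟩
      have := shrink_fst (c := 1 / 2) (hT.subset hv)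
      constructor <;> linarith
    have h1 := (hT.connects.map (continuous_shrink (1 / 2)) (shrink_injective _)).glue_right hr
      (fun v hv => (xr v hv.2).2 (xT v hv.1).2)
    have x1 : ∀ v ∈ shrink (1 / 2) '' T ∪ r, 1 / 4 ≤ v.1 := by
      rintro v (hv | hv)
      · exact (xT v hv).1
      · linarith [(xr v hv).1]
    have h2 := Connects.glue hm h1 (fun v hv => (xm v hv.1).2 (x1 v hv.2))
    have x2 : ∀ v ∈ m ∪ (shrink (1 / 2) '' T ∪ r), -1 / 4 ≤ v.1 ∧
        (v.1 ≤ -1 / 4 → v = shrink (-1 / 2) NE ∨ v = shrink (-1 / 2) SE) := by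
      rintro v (hv | hv)
      · exact xm' v hv
      · have := x1 v hv
        exact ⟨by linarith, fun h => by linarith⟩
    have hS' := hS.connects.map (continuous_shrink (-1 / 2)) (shrink_injective _)
    have hS2 : shrink (-1 / 2) '' S ∩ (m ∪ (shrink (1 / 2) '' T ∪ r)) ⊆
        {shrink (-1 / 2) NE, shrink (-1 / 2) SE} := fun v hv => (x2 v hv.2).2 (xS v hv.1).2
    have h3 : Connects (shrink (-1 / 2) '' S ∪ (m ∪ (shrink (1 / 2) '' T ∪ r)))
        (shrink (-1 / 2) NW) NE (shrink (-1 / 2) SW) SE (sumType τ σ) := by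
      cases σ
      · exact Connects.glue hS' h2 hS2
      · exact absurd rfl hσ
      -- Here `S` leads its NW end to its SE end, so everything to its right is attached with its
      -- two left ends exchanged.
      · rw [pair_comm] at hS2
        have := Connects.glue hS' (n := shrink (-1 / 2) SE)
          (s := shrink (-1 / 2) NE) h2.twist hS2
        exact this
    rw [e]
    refine Connects.glue hl h3 fun v hv => (xl v hv.1).2 ?_
    rcases hv.2 with h | h
    · exact (xS v h).1
    · linarith [(x2 v h).1]
  · have bS := shrink_subset_openBox hS.subset (c := -1 / 2) (by norm_num [abs_le])
    have bT := shrink_subset_openBox hT.subset (c := 1 / 2) (by norm_num [abs_le])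
    have bc : ∀ c : ℝ, |c| ≤ 1 / 2 → ∀ v ∈ corners, shrink c v ∈ openBox := fun c hc v hv =>
      shrink_subset_openBox subset_union_right hc ⟨v, hv, rfl⟩
    have conv : Convex ℝ openBox := by
      have : openBox = Metric.ball (0 : Space) 1 := by
        ext v
        simp [openBox, Prod.norm_def]
      rw [this]; exact convex_ball _ _
    have bl := bc (-1 / 2) (by norm_num [abs_le])
    have br := bc (1 / 2) (by norm_num [abs_le])
    have cNW : NW ∈ corners := by simp [corners]
    have cNE : NE ∈ corners := by simp [corners]
    have cSW : SW ∈ corners := by simp [corners]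
    have cSE : SE ∈ corners := by simp [corners]
    rw [e]
    refine union_subset (union_subset ?_ ?_) <| union_subset (bS.trans subset_union_left) <|
      union_subset (union_subset ?_ ?_) <| union_subset (bT.trans subset_union_left) <|
      union_subset ?_ ?_
    · rw [segment_symm]; exact segment_subset (bl _ cNW) cNW
    · rw [segment_symm]; exact segment_subset (bl _ cSW) cSW
    · exact (conv.segment_subset (bl _ cNE) (br _ cNW)).trans subset_union_left
    · exact (conv.segment_subset (bl _ cSE) (br _ cSW)).trans subset_union_left
    · exact segment_subset (br _ cNE) cNE
    · exact segment_subset (br _ cSE) cSE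

/-- Each further crossing switches between the types `[0]` and `[1]`. Excluding `[∞]` is what makes
integer tangles admissible as left summands. -/
theorem hasType_ofNat (n : ℕ) : ∃ τ, τ ≠ Connectivity.infty ∧ HasType (ofNat n) τ := by
  induction n with
  | zero => exact ⟨_, by simp, hasType_zero⟩
  | succ n ih =>
    obtain ⟨τ, h0, h⟩ := ih
    refine ⟨_, ?_, h.sum hasType_one h0⟩
    cases τ <;> simp_all [sumType, Connectivity.twist]

theorem hasType_ofInt (n : ℤ) : ∃ τ, τ ≠ Connectivity.infty ∧ HasType (ofInt n) τ := by
  cases n with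
  | ofNat n => exact hasType_ofNat n
  | negSucc n =>
    obtain ⟨τ, h0, h⟩ := hasType_ofNat (n + 1)
    exact ⟨τ, h0, h.neg⟩

theorem hasType_contFrac : ∀ l : List ℤ, ∃ τ, HasType (contFrac l) τ
  | [] => ⟨_, hasType_zero.inv⟩
  | [b] => (hasType_ofInt b).imp fun _ h => h.2
  | b :: c :: l => by
    obtain ⟨σ, h0, hσ⟩ := hasType_ofInt b
    obtain ⟨τ, hτ⟩ := hasType_contFrac (c :: l)
    exact ⟨_, hσ.sum hτ.inv h0⟩

theorem HasType.image {T : Set Space} {τ : Connectivity} (h : HasType T τ) (g : Space ≃ₜ Space)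
    (hg : ∀ v ∈ openBoxᶜ, g v = v) : HasType (g '' T) τ := by
  have hc : ∀ v ∈ corners, g v = v := fun v hv => hg v fun hv' => by
    rcases hv with rfl | rfl | rfl | rfl <;> norm_num [openBox, NW, NE, SW, SE] at hv'
  constructor
  · have := h.connects.map g.continuous g.injective
    rwa [hc NW (by simp [corners]), hc NE (by simp [corners]), hc SW (by simp [corners]),
      hc SE (by simp [corners])] at this
  · rintro _ ⟨v, hv, rfl⟩
    rcases h.subset hv with hv | hv
    · left
      -- If `g v` were outside the open box, `g` would fix it, and injectivity would give `g v = v`,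
      -- a point inside.
      by_contra h'
      rw [g.injective (hg _ h')] at h'
      exact h' hv
    · right
      rwa [hc v hv]

theorem IsRational.hasType {R : Set Space} (h : IsRational R) : ∃ τ, HasType R τ := by
  obtain ⟨l, H, -, -, hB, rfl⟩ := h
  obtain ⟨τ, hτ⟩ := hasType_contFrac l
  exact ⟨τ, hτ.image (H 1) (hB 1)⟩

theorem HasType.connectivityZero {T : Set Space} (h : HasType T .zero) : ConnectivityZero T := by
  obtain ⟨A, B, hA, hB, -, rfl⟩ := h.connects
  exact ⟨hA.joinedIn subset_union_left, hB.joinedIn subset_union_right⟩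

theorem HasType.connectivityInfty {T : Set Space} (h : HasType T .infty) :
    ConnectivityInfty T := by
  obtain ⟨A, B, hA, hB, -, rfl⟩ := h.connects
  exact ⟨hA.joinedIn subset_union_left, hB.joinedIn subset_union_right⟩

theorem HasType.connectivityOne {T : Set Space} (h : HasType T .one) : ConnectivityOne T := by
  obtain ⟨A, B, hA, hB, -, rfl⟩ := h.connects
  exact ⟨hA.joinedIn subset_union_left, hB.joinedIn subset_union_right⟩

end Tangle

/-! ### Lifts to the covering strip, winding numbers and homotopy. -/

namespace SolidTorusLink

/-- The projection of the thickened strip to the solid torus; points that are too far out are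
moved to the boundary. -/
noncomputable def cover (v : Space) : SolidTorus :=
  (Circle.exp v.2.1, ⟨(max (-2) (min 2 v.1), max (-2) (min 2 v.2.2)),
    ⟨⟨le_max_left _ _, le_max_left _ _⟩,
      ⟨max_le (by norm_num) (min_le_left _ _), max_le (by norm_num) (min_le_left _ _)⟩⟩⟩)

theorem continuous_cover : Continuous cover := by
  unfold cover; fun_prop

theorem cover_snd {v : Space} (h : |v.1| ≤ 2) (h' : |v.2.2| ≤ 2) :
    ((cover v).2 : ℝ × ℝ) = (v.1, v.2.2) := by
  rw [abs_le] at h h'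
  simp only [cover, min_eq_right h.2, max_eq_right h.1, min_eq_right h'.2, max_eq_right h'.1]

/-- The deck transformation that goes `k` times around. -/
noncomputable def deck (k : ℤ) (v : Space) : Space := (v.1, v.2.1 + k * (2 * Real.pi), v.2.2)

theorem continuous_deck (k : ℤ) : Continuous (deck k) := by
  unfold deck; fun_prop

theorem cover_deck (k : ℤ) (v : Space) : cover (deck k v) = cover v := by
  simp only [cover, deck, Circle.exp_add, Circle.exp_int_mul_two_pi, mul_one]

/-- Each component of `f` winds `k` times around the solid torus. -/
def WindsBy (k : ℤ) {n : ℕ} (f : C(Fin n × Circle, SolidTorus)) : Prop :=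
  ∃ h : C(Fin n × Circle, ℝ), ∀ x, (f x).1 = x.2 ^ k * Circle.exp (h x)

/-- Once the common factor `x.2 ^ k` is split off, the angles are real functions and can be
interpolated linearly; so can the other coordinates, which lie in a convex rectangle. -/
theorem WindsBy.homotopic {k : ℤ} {n : ℕ} {f f' : C(Fin n × Circle, SolidTorus)}
    (hf : WindsBy k f) (hf' : WindsBy k f') : f.Homotopic f' := by
  obtain ⟨h, hh⟩ := hf
  obtain ⟨h', hh'⟩ := hf'
  have conv : ∀ (t : unitInterval) x,
      (1 - (t : ℝ)) • ((f x).2 : ℝ × ℝ) + (t : ℝ) • ((f' x).2 : ℝ × ℝ) ∈ Icc ((-2, -2) : ℝ × ℝ) (2, 2) := fun t x =>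
    convex_Icc _ _ (f x).2.2 (f' x).2.2 (by linarith [t.2.2]) t.2.1 (by ring)
  exact ⟨{
    toFun := fun p => (p.2.2 ^ k * Circle.exp ((1 - (p.1 : ℝ)) * h p.2 + p.1 * h' p.2),
      ⟨_, conv p.1 p.2⟩)
    continuous_toFun := by fun_prop
    map_zero_left := fun x => Prod.ext (by simp [hh]) (Subtype.ext (by simp))
    map_one_left := fun x => Prod.ext (by simp [hh']) (Subtype.ext (by simp)) }⟩

/-- A loop, given by a path in the cover, that goes `k` times around. -/
theorem exists_circle_map {a b : Space} (γ : Path a b) (k : ℤ) (hb : b = deck k a)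
    (hγ : ∀ s t : unitInterval, s < 1 → t < 1 → cover (γ s) = cover (γ t) → s = t) :
    ∃ f : C(Circle, SolidTorus), Injective f ∧ range f = range (cover ∘ γ) ∧
      ∃ h : C(Circle, ℝ), ∀ z, (f z).1 = z ^ k * Circle.exp (h z) := by
  -- Subtracting uniform rotation by `k` turns closes the lifted path, so it descends to the circle.
  -- The factor `z ^ k` in `f` restores the rotation.
  let δ : ℝ → Space := fun t => γ.extend t - (0, k * (2 * Real.pi * t), 0)
  have hδ : Continuous δ := by
    have := γ.continuous_extend
    fun_prop
  have hδ01 : δ 0 = δ 1 := by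
    simp only [δ, Path.extend_zero, Path.extend_one, hb, deck]
    refine Prod.ext (by simp) (Prod.ext (by simp) (by simp))
  let e := AddCircle.homeomorphCircle (T := (1 : ℝ)) one_ne_zero
  let D : Circle → Space := fun z => AddCircle.liftIco 1 0 δ (e.symm z)
  have hD : Continuous D :=
    (AddCircle.liftIco_zero_continuous hδ01 hδ.continuousOn).comp e.symm.continuous
  let f : C(Circle, SolidTorus) := ⟨fun z => (z ^ k * Circle.exp (D z).2.1, (cover (D z)).2), by
    have := continuous_cover
    fun_prop⟩
  have he : ∀ t : ℝ, e t = Circle.exp (2 * Real.pi * t) := fun t => by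
    simp only [e, AddCircle.homeomorphCircle_apply, AddCircle.toCircle_apply_mk, div_one]
  have hf : ∀ t : unitInterval, t < 1 → f (e (t : ℝ)) = cover (γ t) := by
    intro t ht
    have h1 : D (e (t : ℝ)) = δ t := by
      simp only [D, e.symm_apply_apply]
      exact AddCircle.liftIco_zero_coe_apply ⟨t.2.1, ht⟩
    refine Prod.ext ?_ ?_
    · simp only [f, ContinuousMap.coe_mk, h1]
      rw [he, ← Circle.exp_zsmul, ← Circle.exp_add]
      simp [δ, cover]
    · simp [f, h1, δ, cover]
  have hsurj : ∀ z, ∃ t : unitInterval, t < 1 ∧ e (t : ℝ) = z := by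
    intro z
    have : e.symm z ∈ ((↑) : ℝ → AddCircle (1 : ℝ)) '' Ico 0 (0 + 1) := by
      rw [AddCircle.coe_image_Ico_eq]; trivial
    obtain ⟨t, ht, htz⟩ := this
    rw [zero_add] at ht
    exact ⟨⟨t, ht.1, ht.2.le⟩, ht.2, by rw [htz, e.apply_symm_apply]⟩
  refine ⟨f, fun z w hzw => ?_, ?_, ⟨fun z => (D z).2.1, by fun_prop⟩, fun z => rfl⟩
  · obtain ⟨s, hs, rfl⟩ := hsurj z
    obtain ⟨t, ht, rfl⟩ := hsurj w
    rw [hf s hs, hf t ht] at hzw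
    rw [hγ s t hs ht hzw]
  · apply Subset.antisymm
    · rintro _ ⟨z, rfl⟩
      obtain ⟨s, hs, rfl⟩ := hsurj z
      exact ⟨s, (hf s hs).symm⟩
    · rintro _ ⟨t, rfl⟩
      rcases eq_or_lt_of_le t.2.2 with h | h
      · refine ⟨e ((0 : unitInterval) : ℝ), ?_⟩
        rw [hf 0 zero_lt_one]
        have : t = 1 := Subtype.ext h
        simp only [comp_apply, this, Path.source, Path.target, hb, cover_deck]
      · exact ⟨_, hf t h⟩

/-- `K` is a closed curve that winds `k` times around the solid torus. -/
def IsLoop (k : ℤ) (K : Set SolidTorus) : Prop :=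
  ∃ f : C(Circle, SolidTorus), Injective f ∧ range f = K ∧
    ∃ h : C(Circle, ℝ), ∀ z, (f z).1 = z ^ k * Circle.exp (h z)

/-- `L` is a link with `n` components that wind `k` times around the solid torus. -/
def IsWindingLink (n : ℕ) (k : ℤ) (L : Set SolidTorus) : Prop :=
  ∃ f : C(Fin n × Circle, SolidTorus), IsParam f L ∧ WindsBy k f

/-- The winding number is read off from the lift: it is the deck transformation taking its start to
its end. -/
theorem isLoop_union {A B : Set SolidTorus} {a b c : Space} (k : ℤ) (hA : IsArcOver cover A a b)
    (hB : IsArcOver cover B b c) (hc : c = deck k a) (hAB : A ∩ B ⊆ {cover a, cover b}) :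
    IsLoop k (A ∪ B) := by
  obtain ⟨γ, hi, hr⟩ := hA.exists_loop hB hAB (by rw [hc, cover_deck])
  rw [← hr]
  exact exists_circle_map γ k hc hi

theorem isWindingLink_of_isLoop {n : ℕ} {k : ℤ} {K : Fin n → Set SolidTorus}
    (hK : ∀ i, IsLoop k (K i)) (hd : Pairwise (Disjoint on K)) :
    IsWindingLink n k (⋃ i, K i) := by
  choose f hi hr h hh using hK
  have hcont : Continuous fun p : Fin n × Circle => f p.1 p.2 :=
    continuous_prod_of_discrete_left.2 fun i => (f i).continuous
  have hcont' : Continuous fun p : Fin n × Circle => h p.1 p.2 :=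
    continuous_prod_of_discrete_left.2 fun i => (h i).continuous
  refine ⟨⟨_, hcont⟩, ⟨?_, ?_⟩, ⟨_, hcont'⟩, fun p => hh p.1 p.2⟩
  · refine (hcont.isClosedEmbedding ?_).isEmbedding
    rintro ⟨i, z⟩ ⟨j, w⟩ hzw
    obtain rfl : i = j := by
      by_contra hij
      have hij' : Disjoint (K i) (K j) := hd hij
      refine Set.disjoint_left.1 hij' (show f i z ∈ K i from ?_) ?_
      · rw [← hr]; exact mem_range_self z
      · rw [← hr, show f i z = f j w from hzw]; exact mem_range_self w
    exact Prod.ext rfl (hi i hzw)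
  · ext p
    simp only [mem_range, mem_iUnion, Prod.exists, ← hr, ContinuousMap.coe_mk]

theorem IsLoop.isWindingLink {k : ℤ} {K : Set SolidTorus} (hK : IsLoop k K) :
    IsWindingLink 1 k K := by
  have := isWindingLink_of_isLoop (n := 1) (K := fun _ => K) (fun _ => hK)
    (fun i j hij => absurd (Subsingleton.elim i j) hij)
  rwa [iUnion_const] at this

theorem isWindingLink_union {k : ℤ} {K K' : Set SolidTorus} (hK : IsLoop k K) (hK' : IsLoop k K')
    (hd : Disjoint K K') : IsWindingLink 2 k (K ∪ K') := by
  have := isWindingLink_of_isLoop (n := 2) (K := ![K, K']) (k := k)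
    (by rw [Fin.forall_fin_two]; exact ⟨hK, hK'⟩) (by
      intro i j hij
      fin_cases i <;> fin_cases j <;> simp_all [onFun, disjoint_comm])
  rwa [show (⋃ i, ![K, K'] i) = K ∪ K' by ext; simp [Fin.exists_fin_two]] at this

/-- The isotopy carries a parametrization of `K` to one of `L` through a homotopy, so only `K` and
`M` need to be compared, and their winding numbers agree. -/
theorem IsWindingLink.conclusion {n : ℕ} {k : ℤ} {K L M : Set SolidTorus}
    (hK : IsWindingLink n k K) (hL : AmbientIsotopicRel ∅ K L) (hM : IsWindingLink n k M) :
    IsLink n L ∧ SameHomotopyType L M := by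
  obtain ⟨f, ⟨hf, rfl⟩, hk⟩ := hK
  obtain ⟨f', hf', hk'⟩ := hM
  obtain ⟨H, hH, hH0, -, rfl⟩ := hL
  have hp : IsParam ((⟨H 1, (H 1).continuous⟩ : C(SolidTorus, SolidTorus)).comp f)
      (H 1 '' range f) :=
    ⟨(H 1).isEmbedding.comp hf, range_comp (H 1) f⟩
  refine ⟨⟨_, hp⟩, n, _, f', hp, hf', ContinuousMap.Homotopic.trans ?_ (hk.homotopic hk')⟩
  refine ContinuousMap.Homotopic.symm ⟨{
    toFun := fun p => H p.1 (f p.2)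
    continuous_toFun :=
      hH.comp (continuous_fst.prodMk (f.continuous.comp continuous_snd))
    map_zero_left := fun x => by simp [hH0]
    map_one_left := fun x => rfl }⟩

/-! ### The winding numbers of the three model links. -/

theorem isWindingLink_twoCores : IsWindingLink 2 1 twoCores := by
  have key : ∀ x : ℝ, |x| ≤ 1 → IsLoop 1 {p | (p.2 : ℝ × ℝ) = (x, 0)} := by
    intro x hx
    rw [abs_le] at hx
    let c : Icc ((-2, -2) : ℝ × ℝ) (2, 2) := ⟨(x, 0), ⟨by constructor <;> simp; linarith,
      by constructor <;> simp; linarith⟩⟩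
    refine ⟨⟨fun z => (z, c), by fun_prop⟩, fun z w h => (Prod.ext_iff.1 h).1, ?_,
      ContinuousMap.const _ 0, fun z => by simp⟩
    ext ⟨z, p⟩
    simp only [ContinuousMap.coe_mk, mem_range, Prod.mk.injEq, exists_eq_left, mem_ofPred_eq]
    exact ⟨fun h => by rw [← h], fun h => Subtype.ext h.symm⟩
  refine isWindingLink_union (key (-1) (by simp)) (key 1 (by simp)) ?_
  refine Set.disjoint_left.2 fun p hp hp' => ?_
  have := (hp.symm.trans hp' : ((-1, 0) : ℝ × ℝ) = (1, 0))
  norm_num at this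

theorem abs_re_le (z : Circle) : |(z : ℂ).re| ≤ 1 :=
  (Complex.abs_re_le_norm _).trans z.norm_coe.le

theorem abs_im_le (z : Circle) : |(z : ℂ).im| ≤ 1 :=
  (Complex.abs_im_le_norm _).trans z.norm_coe.le

theorem circle_exp_re (t : ℝ) : (Circle.exp t : ℂ).re = Real.cos t := by
  rw [Circle.coe_exp, Complex.exp_ofReal_mul_I_re]

theorem circle_exp_im (t : ℝ) : (Circle.exp t : ℂ).im = Real.sin t := by
  rw [Circle.coe_exp, Complex.exp_ofReal_mul_I_im]

theorem isWindingLink_trivialKnot : IsWindingLink 1 0 trivialKnot := by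
  apply IsLoop.isWindingLink
  have h2 : ∀ z : Circle, ((cover ((z : ℂ).im, (z : ℂ).re, 0)).2 : ℝ × ℝ) = ((z : ℂ).im, 0) :=
    fun z => cover_snd ((abs_im_le z).trans one_le_two) (by simp)
  refine ⟨⟨fun z => cover ((z : ℂ).im, (z : ℂ).re, 0), continuous_cover.comp (by fun_prop)⟩,
    fun z w h => ?_, ?_, ⟨fun z => (z : ℂ).re, by fun_prop⟩, fun z => by simp [cover]⟩
  · have h3 := congrArg (fun p : SolidTorus => (p.2 : ℝ × ℝ).1) h
    have h4 := congrArg Prod.fst h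
    simp only [ContinuousMap.coe_mk, h2] at h3
    have hz := abs_le.1 (abs_re_le z)
    have hw := abs_le.1 (abs_re_le w)
    -- The angle stays in `[-1, 1]`, an interval shorter than `2π`, so it is determined by its
    -- exponential.
    have h5 := Circle.exp_injOn_Icc (a := -1) (b := 1) (by linarith [Real.pi_gt_three]) hz hw h4
    exact Circle.ext (Complex.ext h5 h3)
  · ext p
    simp only [mem_range, ContinuousMap.coe_mk, trivialKnot, mem_ofPred_eq]
    constructor
    · rintro ⟨z, rfl⟩
      obtain ⟨t, rfl⟩ := Circle.exp_surjective z
      exact ⟨t, by rw [← circle_exp_re]; rfl, by rw [h2, circle_exp_im]⟩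
    · rintro ⟨t, h, h'⟩
      refine ⟨Circle.exp t, Prod.ext ?_ (Subtype.ext ?_)⟩
      · rw [h, ← circle_exp_re]; rfl
      · rw [h2, h', circle_exp_im]

theorem isWindingLink_crossingKnot : IsWindingLink 1 2 crossingKnot := by
  apply IsLoop.isWindingLink
  have h2 : ∀ z : Circle, ((cover ((z : ℂ).re, 0, (z : ℂ).im)).2 : ℝ × ℝ) =
      ((z : ℂ).re, (z : ℂ).im) :=
    fun z => cover_snd ((abs_re_le z).trans one_le_two) ((abs_im_le z).trans one_le_two)
  refine ⟨⟨fun z => (z ^ (2 : ℤ), (cover ((z : ℂ).re, 0, (z : ℂ).im)).2), ?_⟩,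
    fun z w h => ?_, ?_, ContinuousMap.const _ 0, fun z => by simp⟩
  · have := continuous_cover
    fun_prop
  · have h3 := congrArg (fun p : SolidTorus => (p.2 : ℝ × ℝ)) h
    simp only [ContinuousMap.coe_mk, h2, Prod.mk.injEq] at h3
    exact Circle.ext (Complex.ext h3.1 h3.2)
  · ext p
    simp only [mem_range, ContinuousMap.coe_mk, crossingKnot, mem_ofPred_eq]
    have h3 : ∀ t : ℝ, Circle.exp t ^ (2 : ℤ) = Circle.exp (2 * t) := fun t => by
      rw [← Circle.exp_zsmul]; simp
    constructor
    · rintro ⟨z, rfl⟩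
      obtain ⟨t, rfl⟩ := Circle.exp_surjective z
      exact ⟨t, h3 t, by rw [h2, circle_exp_re, circle_exp_im]⟩
    · rintro ⟨t, h, h'⟩
      refine ⟨Circle.exp t, Prod.ext ?_ (Subtype.ext ?_)⟩
      · rw [h, h3]
      · rw [h2, h', circle_exp_re, circle_exp_im]

end SolidTorusLink

/-! ### The closures of the three connectivity types. -/

namespace SolidTorusLink

open Tangle

/-- The arc that runs around the annulus outside the box at the radial coordinate `x`. -/
def outerArc (x : ℝ) : Set SolidTorus :=
  {p | ∃ t ∈ Icc 1 (2 * Real.pi - 1), p.1 = Circle.exp t ∧ (p.2 : ℝ × ℝ) = (x, 0)}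

/-- The lift leaves the north end at angle `1` and stops at `2π - 1`, where the next translate of
the south end lies. -/
theorem isArcOver_outerArc {x : ℝ} (hx : |x| ≤ 2) :
    IsArcOver cover (outerArc x) (x, 1, 0) (deck 1 (x, -1, 0)) := by
  have e : deck 1 (x, -1, 0) = (x, 2 * Real.pi - 1, 0) := by
    simp only [deck, Int.cast_one]
    ring_nf
  have hpi := Real.pi_gt_three
  have hseg : segment ℝ ((x, 1, 0) : Space) (x, 2 * Real.pi - 1, 0) =
      (fun t : ℝ => ((x, t, 0) : Space)) '' Icc 1 (2 * Real.pi - 1) := by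
    rw [← Prod.image_mk_segment_right, ← Prod.image_mk_segment_left,
      segment_eq_Icc (by linarith), image_image]
  have h := isArcOver_segment (a := ((x, 1, 0) : Space)) (b := (x, 2 * Real.pi - 1, 0))
    (fun h => by simp only [Prod.mk.injEq] at h; linarith [h.2.1])
  rw [hseg] at h
  replace h := h.comp (r := cover) (by
    rintro _ ⟨s, hs, rfl⟩ _ ⟨t, ht, rfl⟩ hst
    rw [Circle.exp_injOn_Icc (by linarith) hs ht (congrArg Prod.fst hst)])
  rw [e]
  suffices hW : outerArc x =
      cover '' ((fun t : ℝ => ((x, t, 0) : Space)) '' Icc 1 (2 * Real.pi - 1)) by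
    rw [hW]; exact h
  ext p
  simp only [outerArc, mem_ofPred_eq, mem_image, exists_exists_and_eq_and]
  refine exists_congr fun t => and_congr_right fun _ => ?_
  have h2 : ((cover (x, t, 0)).2 : ℝ × ℝ) = (x, 0) := cover_snd hx (by simp)
  constructor
  · rintro ⟨h, h'⟩
    exact Prod.ext h.symm (Subtype.ext (h2.trans h'.symm))
  · rintro rfl
    exact ⟨rfl, h2⟩

theorem cover_snd_of_mem {v : Space} (hv : v ∈ openBox ∪ corners) :
    ((cover v).2 : ℝ × ℝ) = (v.1, v.2.2) :=
  cover_snd ((mem_box hv).1.trans one_le_two) ((mem_box hv).2.2.trans one_le_two)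

theorem injOn_cover : InjOn cover (openBox ∪ corners) := by
  intro v hv w hw h
  have h1 := cover_snd_of_mem hv
  rw [h, cover_snd_of_mem hw, Prod.mk.injEq] at h1
  have h2 := Circle.exp_injOn_Icc (a := -1) (b := 1) (by linarith [Real.pi_gt_three])
    (abs_le.1 (mem_box hv).2.1) (abs_le.1 (mem_box hw).2.1) (congrArg Prod.fst h)
  exact Prod.ext h1.1.symm (Prod.ext h2 h1.2.symm)

theorem closure_eq {T : Set Space} (hT : T ⊆ openBox ∪ corners) :
    Tangle.closure T = cover '' T ∪ (outerArc (-1) ∪ outerArc 1) := by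
  ext p
  simp only [Tangle.closure, outerArc, mem_ofPred_eq, mem_union, mem_image]
  refine or_congr (exists_congr fun v => and_congr_right fun hv => ?_) ?_
  · have h2 := cover_snd_of_mem (hT hv)
    constructor
    · rintro ⟨h, h'⟩
      exact Prod.ext h.symm (Subtype.ext (h2.trans h'.symm))
    · rintro rfl
      exact ⟨rfl, h2⟩
  · simp only [and_or_left, exists_or]

theorem eq_of_cover_mem_left {v : Space} (hv : v ∈ openBox ∪ corners)
    (h : cover v ∈ outerArc (-1)) : v = NW ∨ v = SW := by
  obtain ⟨t, -, -, h⟩ := h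
  rw [cover_snd_of_mem hv, Prod.mk.injEq] at h
  exact eq_of_fst_eq_neg_one hv h.1

theorem eq_of_cover_mem_right {v : Space} (hv : v ∈ openBox ∪ corners)
    (h : cover v ∈ outerArc 1) : v = NE ∨ v = SE := by
  obtain ⟨t, -, -, h⟩ := h
  rw [cover_snd_of_mem hv, Prod.mk.injEq] at h
  exact eq_of_fst_eq_one hv h.1

theorem disjoint_outerArc : ∀ p ∈ outerArc (-1), p ∉ outerArc 1 := by
  rintro p ⟨-, -, -, h⟩ ⟨-, -, -, h'⟩
  rw [h, Prod.mk.injEq] at h'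
  norm_num at h'

/-- The lifts run SW, NW, SW one turn further, and SE, NE, SE one turn further. -/
theorem isWindingLink_closure_infty {T : Set Space} (hT : HasType T .infty) :
    IsWindingLink 2 1 (Tangle.closure T) := by
  obtain ⟨A, B, hA, hB, hd, rfl⟩ := hT.connects
  have hAs : A ⊆ openBox ∪ corners := subset_union_left.trans hT.subset
  have hBs : B ⊆ openBox ∪ corners := subset_union_right.trans hT.subset
  have hW := isArcOver_outerArc (x := -1) (by simp)
  have hE := isArcOver_outerArc (x := 1) (by simp)
  have hl := isLoop_union 1 (hA.comp (injOn_cover.mono hAs)).symm hW rfl (by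
    rintro _ ⟨⟨v, hv, rfl⟩, h⟩
    rcases eq_of_cover_mem_left (hAs hv) h with rfl | rfl
    · exact .inr rfl
    · exact .inl rfl)
  have hr := isLoop_union 1 (hB.comp (injOn_cover.mono hBs)).symm hE rfl (by
    rintro _ ⟨⟨v, hv, rfl⟩, h⟩
    rcases eq_of_cover_mem_right (hBs hv) h with rfl | rfl
    · exact .inr rfl
    · exact .inl rfl)
  rw [closure_eq hT.subset, image_union, union_union_union_comm]
  refine isWindingLink_union hl hr (disjoint_left.2 ?_)
  rw [disjoint_left] at hd
  rintro _ (⟨v, hv, rfl⟩ | h) (⟨w, hw, hvw⟩ | h')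
  · rw [injOn_cover (hBs hw) (hAs hv) hvw] at hw
    exact hd hv hw
  · rcases eq_of_cover_mem_right (hAs hv) h' with rfl | rfl
    · exact hd hv hB.left_mem
    · exact hd hv hB.right_mem
  · subst hvw
    rcases eq_of_cover_mem_left (hBs hw) h with rfl | rfl
    · exact hd hA.left_mem hw
    · exact hd hA.right_mem hw
  · exact disjoint_outerArc _ h h'

/-- The lift runs from NE to NW, around to the first translates of SW and SE, and back along the
other outer arc to NE itself. The two turns cancel. -/
theorem isWindingLink_closure_zero {T : Set Space} (hT : HasType T .zero) :
    IsWindingLink 1 0 (Tangle.closure T) := by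
  obtain ⟨A, B, hA, hB, hd, rfl⟩ := hT.connects
  have hAs : A ⊆ openBox ∪ corners := subset_union_left.trans hT.subset
  have hBs : B ⊆ openBox ∪ corners := subset_union_right.trans hT.subset
  have hW := isArcOver_outerArc (x := -1) (by simp)
  have hE := isArcOver_outerArc (x := 1) (by simp)
  have hA' := (hA.comp (injOn_cover.mono hAs)).symm
  have hB' := (hB.comp (injOn_cover.mono hBs)).deck (continuous_deck 1) (cover_deck 1)
  rw [disjoint_left] at hd
  have h1 := hA'.trans hW (by
    rintro _ ⟨⟨v, hv, rfl⟩, h⟩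
    rcases eq_of_cover_mem_left (hAs hv) h with rfl | rfl
    · rfl
    · exact absurd hB.left_mem (hd hv))
  have h2 := h1.trans hB' (by
    rintro _ ⟨⟨v, hv, rfl⟩ | h, ⟨w, hw, hvw⟩⟩
    · rw [injOn_cover (hBs hw) (hAs hv) hvw] at hw
      exact absurd hw (hd hv)
    · subst hvw
      rcases eq_of_cover_mem_left (hBs hw) h with rfl | rfl
      · exact absurd hw (hd hA.left_mem)
      · exact (cover_deck 1 SW).symm)
  have h3 := isLoop_union 0 h2 hE.symm (by simp [deck, NE]) (by
    rintro _ ⟨(⟨v, hv, rfl⟩ | h) | ⟨v, hv, rfl⟩, h'⟩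
    · rcases eq_of_cover_mem_right (hAs hv) h' with rfl | rfl
      · exact .inl rfl
      · exact absurd hB.right_mem (hd hv)
    · exact absurd h' (disjoint_outerArc _ h)
    · rcases eq_of_cover_mem_right (hBs hv) h' with rfl | rfl
      · exact absurd hv (hd hA.right_mem)
      · exact .inr (cover_deck 1 SE).symm)
  rw [closure_eq hT.subset, image_union]
  convert h3.isWindingLink using 1
  ext p; simp only [mem_union]; tauto

/-- The lift runs from SW to NE, around to the first translates of SE and NW, and around again to
the second translate of SW. Both outer arcs are traversed in the same direction. -/
theorem isWindingLink_closure_one {T : Set Space} (hT : HasType T .one) :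
    IsWindingLink 1 2 (Tangle.closure T) := by
  obtain ⟨A, B, hA, hB, hd, rfl⟩ := hT.connects
  have hAs : A ⊆ openBox ∪ corners := subset_union_left.trans hT.subset
  have hBs : B ⊆ openBox ∪ corners := subset_union_right.trans hT.subset
  have hW := (isArcOver_outerArc (x := -1) (by simp)).deck (continuous_deck 1) (cover_deck 1)
  have hE := isArcOver_outerArc (x := 1) (by simp)
  have hA' := (hA.comp (injOn_cover.mono hAs)).symm.deck (continuous_deck 1) (cover_deck 1)
  have hB' := hB.comp (injOn_cover.mono hBs)
  rw [disjoint_left] at hd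
  have h1 := hB'.trans hE (by
    rintro _ ⟨⟨v, hv, rfl⟩, h⟩
    rcases eq_of_cover_mem_right (hBs hv) h with rfl | rfl
    · rfl
    · exact absurd hv (hd hA.right_mem))
  have h2 := h1.trans hA' (by
    rintro _ ⟨⟨v, hv, rfl⟩ | h, ⟨w, hw, hvw⟩⟩
    · rw [injOn_cover (hAs hw) (hBs hv) hvw] at hw
      exact absurd hv (hd hw)
    · subst hvw
      rcases eq_of_cover_mem_right (hAs hw) h with rfl | rfl
      · exact absurd hB.right_mem (hd hw)
      · exact (cover_deck 1 SE).symm)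
  have h3 := isLoop_union 2 h2 hW (by simp [deck, SW]; ring) (by
    rintro _ ⟨(⟨v, hv, rfl⟩ | h) | ⟨v, hv, rfl⟩, h'⟩
    · rcases eq_of_cover_mem_left (hBs hv) h' with rfl | rfl
      · exact absurd hv (hd hA.left_mem)
      · exact .inl rfl
    · exact absurd h (disjoint_outerArc _ h')
    · rcases eq_of_cover_mem_left (hAs hv) h' with rfl | rfl
      · exact .inr (cover_deck 1 NW).symm
      · exact absurd hB.left_mem (hd hv))
  rw [closure_eq hT.subset, image_union]
  convert h3.isWindingLink using 1
  ext p; simp only [mem_union]; tauto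

end SolidTorusLink

theorem mainTheorem8 (R : Set Space) (L : Set SolidTorus)
    (hL : SolidTorusLink.IsRationalWith R L) :
    (Tangle.ConnectivityInfty R ∧ SolidTorusLink.IsLink 2 L ∧
        SolidTorusLink.SameHomotopyType L SolidTorusLink.twoCores) ∨
      (Tangle.ConnectivityZero R ∧ SolidTorusLink.IsKnot L ∧
        SolidTorusLink.SameHomotopyType L SolidTorusLink.trivialKnot) ∨
      (Tangle.ConnectivityOne R ∧ SolidTorusLink.IsKnot L ∧
        SolidTorusLink.SameHomotopyType L SolidTorusLink.crossingKnot) := by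
  obtain ⟨hR, hL⟩ := hL
  obtain ⟨τ, hτ⟩ := hR.hasType
  cases τ
  · exact .inr (.inl ⟨hτ.connectivityZero, (SolidTorusLink.isWindingLink_closure_zero hτ).conclusion
      hL SolidTorusLink.isWindingLink_trivialKnot⟩)
  · exact .inl ⟨hτ.connectivityInfty, (SolidTorusLink.isWindingLink_closure_infty hτ).conclusion
      hL SolidTorusLink.isWindingLink_twoCores⟩
  · exact .inr (.inr ⟨hτ.connectivityOne, (SolidTorusLink.isWindingLink_closure_one hτ).conclusion
      hL SolidTorusLink.isWindingLink_crossingKnot⟩)
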